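/- Let $f:(0,\infty)\to\mathbb C$ be in $L^1(0,\infty;dx)$, let $0<\sigma<1$, and suppose that $$\int_0^\infty |f(x)|\,x^{\sigma-1}\,dx<\infty .$$ Put $\widehat f(s)=\int_0^\infty f(x)x^{s-1}\,dx$ for $\mathrm{Re}(s)=\sigma$, and let $$A_f(x)=\sum_{n\ge1} f(nx)-\frac{1}{x}\int_0^\infty f(t)\,dt ,$$ where the series converges absolutely for almost every $x>0$. Then the function $u\mapsto e^{\sigma u}A_f(e^u)$, that is, $x^\sigma A_f(x)$ as a function of $u=\log x\in\mathbb R$, is locally integrable and is a tempered distribution: there is a tempered distribution $S$ on $\mathbb R$ with $\langle S,\varphi\rangle=\int_{\mathbb R}e^{\sigma u}A_f(e^u)\varphi(u)\,du$ for all $\varphi\in C_c^\infty(\mathbb R)$. The Müntz identity $$\int_0^\infty x^\sigma A_f(x)\,x^{i\tau}\,\frac{dx}{x}=\zeta(\sigma+i\tau)\,\widehat f(\sigma+i\tau)$$ holds as an identity of tempered distributions in $\tau\in\mathbb R$, the integral representing the Fourier transform of a tempered distribution. That is, for every Schwartz function $\varphi$ on $\mathbb R$ the function $\varphi(\tau)\zeta(\sigma+i\tau)\widehat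 f(\sigma+i\tau)$ is integrable, and $$\Big\langle S,\;u\mapsto\int_{\mathbb R}\varphi(\tau)e^{i\tau u}\,d\tau\Big\rangle=\int_{\mathbb R}\zeta(\sigma+i\tau)\,\widehat f(\sigma+i\tau)\,\varphi(\tau)\,d\tau .$$ -/

import Mathlib

open MeasureTheory Set
open scoped SchwartzMap FourierTransform

noncomputable section

/-- The modified Poisson sum `A_f(x) = ∑_{n ≥ 1} f(n x) - (∫_0^∞ f(t) dt) / x`. -/
def muntzSum (f : ℝ → ℂ) (x : ℝ) : ℂ :=
  (∑' n : ℕ, f (((n : ℝ) + 1) * x)) - (∫ t in Ioi (0 : ℝ), f t) / (x : ℂ)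

/-- The tempered distribution `T` is the locally integrable function `g`: they agree as
distributions, that is, on all smooth compactly supported test functions. (The products `φ g` need
not be integrable for a general Schwartz function `φ`; `T` is then determined by density.) -/
def IsTemperedExtension (g : ℝ → ℂ) (T : 𝓢'(ℝ, ℂ)) : Prop :=
  LocallyIntegrable g volume ∧
    ∀ φ : 𝓢(ℝ, ℂ), HasCompactSupport (φ : ℝ → ℂ) → T φ = ∫ u : ℝ, φ u * g u

/-- The Fourier transform with the kernel `e^{iτu}` on Schwartz functions:
`φ ↦ (u ↦ ∫ φ(τ) e^{iτu} dτ)`; see `expFourierSchwartz_apply`. -/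
def expFourierSchwartz : 𝓢(ℝ, ℂ) →L[ℂ] 𝓢(ℝ, ℂ) :=
  (SchwartzMap.compCLMOfContinuousLinearEquiv ℂ
    (ContinuousLinearEquiv.unitsEquivAut ℝ
      (Units.mk0 (2 * Real.pi)⁻¹ (inv_ne_zero Real.two_pi_pos.ne')))).comp
    (FourierTransform.fourierInvCLM ℂ 𝓢(ℝ, ℂ))

theorem expFourierSchwartz_apply (φ : 𝓢(ℝ, ℂ)) (u : ℝ) :
    expFourierSchwartz φ u = ∫ τ : ℝ, φ τ * Complex.exp (Complex.I * τ * u) := by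
  have h : expFourierSchwartz φ u = (𝓕⁻ (φ : ℝ → ℂ)) (u * (2 * Real.pi)⁻¹) := by
    rw [← SchwartzMap.fourierInv_coe]
    rfl
  rw [h, Real.fourierInv_eq']
  refine integral_congr_ae (Filter.Eventually.of_forall fun τ => ?_)
  have hpi : (Real.pi : ℂ) ≠ 0 := by exact_mod_cast Real.pi_ne_zero
  simp only [smul_eq_mul, RCLike.inner_apply, conj_trivial]
  rw [mul_comm]
  congr 2
  push_cast
  field_simp

/-- The Fourier transform `∫ S(u) e^{iτu} du` of a tempered distribution `S`, by duality:
`⟨F S, φ⟩ = ⟨S, u ↦ ∫ φ(τ) e^{iτu} dτ⟩`. -/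
def expFourier (S : 𝓢'(ℝ, ℂ)) : 𝓢'(ℝ, ℂ) :=
  PointwiseConvergenceCLM.precomp ℂ expFourierSchwartz S

theorem expFourier_apply (S : 𝓢'(ℝ, ℂ)) (φ : 𝓢(ℝ, ℂ)) :
    expFourier S φ = S (expFourierSchwartz φ) := rfl

end

/-! In the strip 0 < Re s < 1 one has ζ(s) = -s ∫_0^∞ {v} v^{-s-1} dv. With v = e^t and x = e^u,
this integral and the Mellin transform of f become, on Re s = σ, Fourier transforms of integrable
functions. Hence ζ(s) f̂(s) is s times a bounded continuous function of τ and defines a tempered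
distribution T (`exists_temperedDistribution_zeta_mul_mellin`). If S is the inverse Fourier
transform of T, the Müntz identity is automatic; what remains is to recognise S as x^σ A_f(x) on
compactly supported tests φ = `expFourierSchwartz ψ`.

There the dilation sum is moved from f to the test function. With χ(v) = e^{σv} φ(v),
Euler-Maclaurin summation of t ↦ χ(w - t) turns ∑ χ(w - log n) - e^w ∫ e^{-u} χ(u) du into an
integral against {e^t}, which on the Fourier side is multiplication of ψ by ζ(σ + iτ)
(`tsum_shift_sub_eq_integral_fract`). Integrate this against f(e^w): Fubini produces ∫ ψ ζ f̂, while
translation by log n returns the sum to f (`integral_mul_tsum_shift`). At most e^{w+R} translates of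
χ are nonzero at a given w, so f ∈ L^1 justifies the interchange. -/

/-! ### The zeta function on Re s > 0 via the fractional part -/

theorem mellin_indicator_fract (z : ℂ) :
    mellin ((Ioi (1 : ℝ)).indicator fun v => ((Int.fract v : ℝ) : ℂ)) (-z) =
      ∫ t in Ioi (1 : ℝ), ((Int.fract t : ℝ) : ℂ) * (t : ℂ) ^ (-(z + 1)) := by
  have : ∀ t : ℝ, (t : ℂ) ^ (-z - 1) • (Ioi (1 : ℝ)).indicator
      (fun v => ((Int.fract v : ℝ) : ℂ)) t = (Ioi (1 : ℝ)).indicator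
        (fun t => ((Int.fract t : ℝ) : ℂ) * (t : ℂ) ^ (-(z + 1))) t := by
    intro t
    by_cases ht : t ∈ Ioi (1 : ℝ)
    · rw [indicator_of_mem ht, indicator_of_mem ht, smul_eq_mul, mul_comm, neg_add']
    · rw [indicator_of_notMem ht, indicator_of_notMem ht, smul_zero]
  rw [mellin]
  simp_rw [this]
  rw [setIntegral_indicator measurableSet_Ioi,
    inter_eq_right.2 (Ioi_subset_Ioi (zero_le_one' ℝ))]

open Filter Topology in
/-- Entire-minus-pole form of `ζ` on the right half-plane, from Euler-Maclaurin summation. -/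
theorem riemannZeta₀_eq_one_sub_mul_mellin {s : ℂ} (hs : 0 < s.re) :
    riemannZeta₀ s =
      1 - s * mellin ((Ioi (1 : ℝ)).indicator fun v => ((Int.fract v : ℝ) : ℂ)) (-s) := by
  set g : ℝ → ℂ := (Ioi (1 : ℝ)).indicator fun v => ((Int.fract v : ℝ) : ℂ) with hg
  have hgm : Measurable g := by
    refine Measurable.indicator ?_ measurableSet_Ioi
    exact Complex.measurable_ofReal.comp measurable_fract
  have hgb : ∀ v, ‖g v‖ ≤ 1 := by
    intro v
    rw [hg]
    refine (norm_indicator_le_norm_self _ _).trans ?_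
    rw [Complex.norm_real, Real.norm_of_nonneg (Int.fract_nonneg v)]
    exact (Int.fract_lt_one v).le
  have hgl : LocallyIntegrableOn g (Ioi 0) := by
    refine LocallyIntegrable.locallyIntegrableOn ?_ _
    refine (locallyIntegrable_const (1 : ℝ)).mono hgm.aestronglyMeasurable ?_
    exact Eventually.of_forall fun v => by simpa using hgb v
  have htop : g =O[atTop] (fun x : ℝ => x ^ (-(0 : ℝ))) := by
    refine Asymptotics.IsBigO.of_bound 1 (Eventually.of_forall fun v => ?_)
    simpa using hgb v
  -- Since g vanishes on (0, 1), every exponent b is allowed, so the Mellin integral at -s is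
  -- constrained only at infinity, where boundedness of g requires Re s > 0.
  have hbot (b : ℝ) : g =O[𝓝[>] 0] (fun x : ℝ => x ^ (-b)) := by
    refine Asymptotics.IsBigO.of_bound 1 ?_
    filter_upwards [Ioo_mem_nhdsGT (show (0 : ℝ) < 1 by norm_num)] with v hv
    have : g v = 0 := by rw [hg]; exact indicator_of_notMem (by simpa using hv.2.le) _
    rw [this, norm_zero]; positivity
  have hU : IsOpen {s : ℂ | 0 < s.re} := isOpen_lt continuous_const Complex.continuous_re
  have han : AnalyticOnNhd ℂ (fun s => 1 - s * mellin g (-s)) {s : ℂ | 0 < s.re} := by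
    refine DifferentiableOn.analyticOnNhd (fun z hz => ?_) hU
    have hz' : 0 < z.re := hz
    have := mellin_differentiableAt_of_isBigO_rpow (s := -z) hgl htop (by simpa using hz')
      (hbot (-z.re - 1)) (by simp)
    have h2 : DifferentiableAt ℂ (fun z => mellin g (-z)) z :=
      DifferentiableAt.comp (g := mellin g) (f := fun z : ℂ => -z) z this differentiableAt_id.neg
    exact ((differentiableAt_const _).sub (differentiableAt_id.mul h2)).differentiableWithinAt
  -- Identity theorem: both sides are analytic on the connected half-plane and agree near 2, where
  -- Abel summation gives ζ(z) = z ∫_1^∞ ⌊t⌋ t^{-z-1} dt.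
  have heq : EqOn riemannZeta₀ (fun s => 1 - s * mellin g (-s)) {s : ℂ | 0 < s.re} := by
    refine (differentiable_riemannZeta₀.differentiableOn.analyticOnNhd
      hU).eqOn_of_preconnected_of_eventuallyEq han
        (convex_halfSpace_re_gt 0).isPreconnected (z₀ := 2) (by simp) ?_
    refine eventuallyEq_of_mem ((isOpen_lt continuous_const Complex.continuous_re).mem_nhds
      (show (1 : ℝ) < (2 : ℂ).re by norm_num)) fun z (hz : 1 < z.re) => ?_
    have hz1 : z ≠ 1 := by rintro rfl; simp at hz
    have hz1' : z - 1 ≠ 0 := sub_ne_zero.2 hz1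
    have hz0 : z ≠ 0 := by rintro rfl; norm_num at hz
    have hL := LSeries_eq_mul_integral_of_nonneg (fun _ => 1) (r := 1) zero_le_one (s := z) hz
      (by simpa using Asymptotics.isBigO_refl _ _) (fun _ => zero_le_one)
    have hL' : riemannZeta z = z * ∫ t in Ioi (1 : ℝ), ((t : ℂ) - ((Int.fract t : ℝ) : ℂ)) *
        (t : ℂ) ^ (-(z + 1)) := by
      rw [← LSeries_one_eq_riemannZeta hz]
      have e1 : LSeries 1 z = LSeries (fun n ↦ (((fun _ => 1 : ℕ → ℝ) n : ℝ) : ℂ)) z := by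
        congr 1
      rw [e1, hL]
      congr 1
      refine setIntegral_congr_fun measurableSet_Ioi fun t (ht : 1 < t) => ?_
      have h0 : (0 : ℝ) ≤ t := by linarith
      simp only [Complex.ofReal_one, Finset.sum_const, Nat.card_Icc, add_tsub_cancel_right,
        nsmul_eq_mul, mul_one]
      rw [← Complex.ofReal_sub, Int.self_sub_fract, ← natCast_floor_eq_intCast_floor h0]
      simp
    have i1 : IntegrableOn (fun t : ℝ => (t : ℂ) ^ (-z)) (Ioi 1) :=
      (integrableOn_Ioi_cpow_iff zero_lt_one).2 (by simpa using hz)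
    have hM := mellin_indicator_fract z
    rw [← hg] at hM
    have i2 : IntegrableOn (fun t : ℝ => ((Int.fract t : ℝ) : ℂ) * (t : ℂ) ^ (-(z + 1))) (Ioi 1) := by
      have : IntegrableOn (fun t : ℝ => (t : ℂ) ^ (-(z + 1))) (Ioi 1) :=
        (integrableOn_Ioi_cpow_iff zero_lt_one).2 (by simp; linarith)
      refine Integrable.mono this ?_ (Eventually.of_forall fun v => ?_)
      · exact (Complex.measurable_ofReal.comp measurable_fract).aestronglyMeasurable.mul
          this.aestronglyMeasurable
      · rw [norm_mul, Complex.norm_real, Real.norm_of_nonneg (Int.fract_nonneg v)]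
        exact mul_le_of_le_one_left (norm_nonneg _) (Int.fract_lt_one v).le
    have hsplit : ∫ t in Ioi (1 : ℝ), ((t : ℂ) - ((Int.fract t : ℝ) : ℂ)) * (t : ℂ) ^ (-(z + 1)) =
        1 / (z - 1) - mellin g (-z) := by
      have e1 : ∫ t in Ioi (1 : ℝ), (t : ℂ) ^ (-z) = 1 / (z - 1) := by
        rw [integral_Ioi_cpow_of_lt (by simpa using hz) zero_lt_one]
        rw [Complex.ofReal_one, Complex.one_cpow, neg_div, ← div_neg]
        congr 1; ring
      rw [hM, ← e1, ← integral_sub i1 i2]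
      refine setIntegral_congr_fun measurableSet_Ioi fun t (ht : 1 < t) => ?_
      have h0 : (t : ℂ) ≠ 0 := by exact_mod_cast (by linarith : t ≠ 0)
      have : (t : ℂ) ^ (-z) = t * (t : ℂ) ^ (-(z + 1)) := by
        rw [show -z = 1 + -(z + 1) by ring, Complex.cpow_add _ _ h0, Complex.cpow_one]
      simp only [this]; ring
    rw [riemannZeta₀, if_neg hz1, hL', hsplit]
    field_simp
    ring
  exact heq hs

/-! ### Logarithmic coordinates and zeta in the critical strip -/

theorem integral_Ioi_zero_eq_integral_exp {E : Type*} [NormedAddCommGroup E] [NormedSpace ℝ E]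
    (F : ℝ → E) : ∫ x in Ioi (0 : ℝ), F x = ∫ u : ℝ, Real.exp u • F (Real.exp u) := by
  have := integral_image_eq_integral_abs_deriv_smul MeasurableSet.univ
    (fun x _ => (Real.hasDerivAt_exp x).hasDerivWithinAt) Real.exp_injective.injOn F
  simpa [image_univ, Real.range_exp] using this

theorem integrableOn_Ioi_zero_iff_integrable_exp {E : Type*} [NormedAddCommGroup E]
    [NormedSpace ℝ E] (F : ℝ → E) :
    IntegrableOn F (Ioi 0) ↔ Integrable fun u : ℝ => Real.exp u • F (Real.exp u) := by
  have := integrableOn_image_iff_integrableOn_abs_deriv_smul MeasurableSet.univ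
    (fun x _ => (Real.hasDerivAt_exp x).hasDerivWithinAt) Real.exp_injective.injOn F
  simpa [image_univ, Real.range_exp] using this

theorem ofReal_exp_cpow (u : ℝ) (s : ℂ) : ((Real.exp u : ℝ) : ℂ) ^ s = Complex.exp (u * s) := by
  rw [Complex.ofReal_exp, Complex.cpow_def_of_ne_zero (Complex.exp_ne_zero _),
    ← Complex.ofReal_exp, ← Complex.ofReal_log (Real.exp_pos u).le, Real.log_exp]

theorem mellin_eq_integral_exp (f : ℝ → ℂ) (σ τ : ℝ) :
    mellin f ((σ : ℂ) + Complex.I * τ) =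
      ∫ u : ℝ, (Real.exp (σ * u) * f (Real.exp u)) * Complex.exp (Complex.I * τ * u) := by
  rw [mellin, integral_Ioi_zero_eq_integral_exp]
  refine integral_congr_ae (Filter.Eventually.of_forall fun u => ?_)
  simp only [ofReal_exp_cpow, smul_eq_mul, Complex.real_smul]
  rw [Complex.ofReal_exp, Complex.ofReal_exp, ← mul_assoc, ← Complex.exp_add, mul_right_comm,
    ← Complex.exp_add]
  congr 2
  push_cast
  ring

/-- As t → -∞, {e^t} ≤ e^t and σ < 1 gives decay; as t → +∞, {e^t} ≤ 1 and σ > 0 does. -/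
theorem integrable_fract_exp_mul {σ : ℝ} (h0 : 0 < σ) (h1 : σ < 1) :
    Integrable fun t : ℝ => Int.fract (Real.exp t) * Real.exp (-σ * t) := by
  have m : Measurable fun t : ℝ => Int.fract (Real.exp t) * Real.exp (-σ * t) := by fun_prop
  rw [← integrableOn_univ, ← Iic_union_Ioi (a := (0 : ℝ)), integrableOn_union]
  constructor
  · refine Integrable.mono (integrableOn_exp_mul_Iic (show 0 < 1 - σ by linarith) 0)
      m.aestronglyMeasurable (Filter.Eventually.of_forall fun t => ?_)
    rw [Real.norm_of_nonneg (mul_nonneg (Int.fract_nonneg _) (Real.exp_pos _).le),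
      Real.norm_of_nonneg (Real.exp_pos _).le, sub_mul, one_mul, sub_eq_add_neg, ← neg_mul,
      Real.exp_add]
    gcongr
    have : (0 : ℤ) ≤ ⌊Real.exp t⌋ := Int.floor_nonneg.2 (Real.exp_pos t).le
    have : (0 : ℝ) ≤ ⌊Real.exp t⌋ := by exact_mod_cast this
    linarith [Int.floor_add_fract (Real.exp t)]
  · refine Integrable.mono (integrableOn_exp_mul_Ioi (show -σ < 0 by linarith) 0)
      m.aestronglyMeasurable (Filter.Eventually.of_forall fun t => ?_)
    rw [Real.norm_of_nonneg (mul_nonneg (Int.fract_nonneg _) (Real.exp_pos _).le),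
      Real.norm_of_nonneg (Real.exp_pos _).le]
    exact mul_le_of_le_one_left (Real.exp_pos _).le (Int.fract_lt_one _).le

/-- `ζ(s) = -s ∫_0^∞ {v} v^{-s-1} dv` in the critical strip, with `v = e^t`. -/
theorem riemannZeta_eq_neg_mul_integral_fract {σ : ℝ} (h0 : 0 < σ) (h1 : σ < 1) (τ : ℝ) :
    riemannZeta ((σ : ℂ) + Complex.I * τ) = -((σ : ℂ) + Complex.I * τ) *
      ∫ t : ℝ, ((Int.fract (Real.exp t) * Real.exp (-σ * t) : ℝ) : ℂ) *
        Complex.exp (-(Complex.I * τ * t)) := by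
  set s : ℂ := (σ : ℂ) + Complex.I * τ with hs
  have hre : s.re = σ := by simp [hs]
  have hs1 : s ≠ 1 := by
    intro h; rw [h] at hre; simp at hre; linarith
  have hs1' : s - 1 ≠ 0 := sub_ne_zero.2 hs1
  have key : ∫ t : ℝ, ((Int.fract (Real.exp t) * Real.exp (-σ * t) : ℝ) : ℂ) *
        Complex.exp (-(Complex.I * τ * t)) =
      mellin (fun v : ℝ => ((Int.fract v : ℝ) : ℂ)) (-s) := by
    have := mellin_eq_integral_exp (fun v : ℝ => ((Int.fract v : ℝ) : ℂ)) (-σ) (-τ)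
    rw [show -s = ((-σ : ℝ) : ℂ) + Complex.I * ((-τ : ℝ) : ℂ) by rw [hs]; push_cast; ring, this]
    congr 1
    ext t
    push_cast
    rw [mul_comm (Complex.exp _) ((Int.fract (Real.exp t) : ℝ) : ℂ)]
    congr 2
    ring
  have hint : IntegrableOn (fun t : ℝ => (t : ℂ) ^ (-s - 1) • ((Int.fract t : ℝ) : ℂ))
      (Ioi 0) := by
    rw [integrableOn_Ioi_zero_iff_integrable_exp]
    have h := (integrable_fract_exp_mul h0 h1).ofReal (𝕜 := ℂ)
    refine h.mono ?_ (Filter.Eventually.of_forall fun t => ?_)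
    · refine Measurable.aestronglyMeasurable ?_
      have : Measurable fun t : ℝ => ((Int.fract (Real.exp t) : ℝ) : ℂ) := by fun_prop
      simp only [ofReal_exp_cpow]
      fun_prop
    · apply le_of_eq
      simp only [ofReal_exp_cpow, norm_smul, Complex.norm_exp, Complex.norm_real, norm_mul,
        Complex.coe_algebraMap, Real.norm_eq_abs, Real.abs_exp]
      rw [← mul_assoc, ← Real.exp_add, mul_comm]
      congr 2
      simp [hre]
      ring
  rw [key, riemannZeta_eq_inv_sub_add hs1, riemannZeta₀_eq_one_sub_mul_mellin (by rw [hre]; exact h0),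
    mellin_indicator_fract, mellin, ← Ioc_union_Ioi_eq_Ioi (zero_le_one' ℝ),
    setIntegral_union (Ioc_disjoint_Ioi le_rfl) measurableSet_Ioi
      (hint.mono_set Ioc_subset_Ioi_self) (hint.mono_set (Ioi_subset_Ioi zero_le_one))]
  have e1 : ∫ t in Ioi (1 : ℝ), (t : ℂ) ^ (-s - 1) • ((Int.fract t : ℝ) : ℂ) =
      ∫ t in Ioi (1 : ℝ), ((Int.fract t : ℝ) : ℂ) * (t : ℂ) ^ (-(s + 1)) := by
    simp only [smul_eq_mul, neg_add', mul_comm]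
  -- On (0, 1) the fractional part is t itself; the resulting 1/(1 - s) absorbs the pole term,
  -- because 1/(s - 1) + 1 = -s/(1 - s).
  have e2 : ∫ t in Ioc (0 : ℝ) 1, (t : ℂ) ^ (-s - 1) • ((Int.fract t : ℝ) : ℂ) =
      1 / (1 - s) := by
    have : ∫ t in Ioc (0 : ℝ) 1, (t : ℂ) ^ (-s - 1) • ((Int.fract t : ℝ) : ℂ) =
        ∫ t in (0 : ℝ)..1, (t : ℂ) ^ (-s) := by
      rw [intervalIntegral.integral_of_le zero_le_one, integral_Ioc_eq_integral_Ioo,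
        integral_Ioc_eq_integral_Ioo]
      refine setIntegral_congr_fun measurableSet_Ioo fun t ht => ?_
      have h0 : (t : ℂ) ≠ 0 := by exact_mod_cast ht.1.ne'
      simp only [smul_eq_mul]
      rw [Int.fract_eq_self.2 ⟨ht.1.le, ht.2⟩, Complex.cpow_sub _ _ h0, Complex.cpow_one]
      field_simp
    rw [this, integral_cpow (Or.inl (by simp [hre]; exact h1)), Complex.ofReal_zero,
      Complex.ofReal_one, Complex.one_cpow, Complex.zero_cpow, sub_zero, neg_add_eq_sub]
    rw [neg_add_eq_sub]; exact fun h => hs1' (by linear_combination -h)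
  rw [e1, e2]
  have : 1 - s ≠ 0 := fun h => hs1' (by linear_combination -h)
  have e3 : (s - 1)⁻¹ = - (1 / (1 - s)) := by rw [← neg_sub s 1, one_div, inv_neg, neg_neg]
  rw [e3]
  have e4 : (1 - s) * (1 / (1 - s)) = 1 := by field_simp
  linear_combination -e4

/-! ### Series of functions with summable L¹ norms -/

section SumIntegral

variable {α E : Type*} [MeasurableSpace α] {μ : Measure α} [NormedAddCommGroup E]

theorem lintegral_tsum_enorm_ne_top {F : ℕ → α → E}
    (hF : ∀ n, Integrable (F n) μ) (hs : Summable fun n => ∫ a, ‖F n a‖ ∂μ) :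
    ∫⁻ a, ∑' n, ‖F n a‖ₑ ∂μ ≠ ⊤ := by
  rw [lintegral_tsum fun n => (hF n).1.enorm]
  have : ∀ n, ∫⁻ a, ‖F n a‖ₑ ∂μ = ENNReal.ofReal (∫ a, ‖F n a‖ ∂μ) := fun n =>
    (ofReal_integral_norm_eq_lintegral_enorm (hF n)).symm
  simp_rw [this]
  exact hs.tsum_ofReal_ne_top

theorem ae_summable_norm_of_summable_integral_norm {F : ℕ → α → E}
    (hF : ∀ n, Integrable (F n) μ) (hs : Summable fun n => ∫ a, ‖F n a‖ ∂μ) :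
    ∀ᵐ a ∂μ, Summable fun n => ‖F n a‖ := by
  have h1 := lintegral_tsum_enorm_ne_top hF hs
  filter_upwards [ae_lt_top' (AEMeasurable.tsum fun n => (hF n).1.enorm) h1] with a ha
  have := ENNReal.summable_toReal ha.ne
  simpa using this

theorem integrable_tsum_of_summable_integral_norm [CompleteSpace E] {F : ℕ → α → E}
    (hF : ∀ n, Integrable (F n) μ) (hs : Summable fun n => ∫ a, ‖F n a‖ ∂μ) :
    Integrable (fun a => ∑' n, F n a) μ := by
  have hae := ae_summable_norm_of_summable_integral_norm hF hs
  have hm : AEStronglyMeasurable (fun a => ∑' n, F n a) μ := by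
    refine aestronglyMeasurable_of_tendsto_ae Filter.atTop
      (f := fun (N : ℕ) a => ∑ n ∈ Finset.range N, F n a)
      (fun N => Finset.aestronglyMeasurable_fun_sum _ fun n _ => (hF n).1) ?_
    filter_upwards [hae] with a ha
    exact ha.of_norm.hasSum.tendsto_sum_nat
  refine ⟨hm, ?_⟩
  have h1 := lintegral_tsum_enorm_ne_top hF hs
  refine lt_of_le_of_lt (lintegral_mono_ae ?_) h1.lt_top
  filter_upwards [hae] with a ha
  rw [← ofReal_norm]
  refine (ENNReal.ofReal_le_ofReal (norm_tsum_le_tsum_norm ha)).trans ?_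
  rw [ENNReal.ofReal_tsum_of_nonneg (fun _ => norm_nonneg _) ha]
  simp

end SumIntegral

/-! ### Euler-Maclaurin summation in the logarithmic variable -/

theorem cast_floor_eq_sum_range_ite {x : ℝ} (hx : 0 ≤ x) {N : ℕ} (hN : x ≤ N) :
    ((⌊x⌋ : ℤ) : ℝ) = ∑ n ∈ Finset.range N, if (n : ℝ) + 1 ≤ x then (1 : ℝ) else 0 := by
  rw [← natCast_floor_eq_intCast_floor hx, Finset.sum_boole]
  congr 1
  have : (Finset.range N).filter (fun n : ℕ => (n : ℝ) + 1 ≤ x) = Finset.range ⌊x⌋₊ := by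
    ext n
    have h : ((n : ℝ) + 1 ≤ x) ↔ n < ⌊x⌋₊ := by
      rw [← Nat.succ_le_iff, Nat.le_floor_iff hx]; push_cast; rfl
    simp only [Finset.mem_filter, Finset.mem_range, h, and_iff_right_iff_imp]
    intro h
    exact h.trans_le (Nat.floor_le_of_le hN)
  rw [this, Finset.card_range]

/-- First-order Euler-Maclaurin summation for a `C¹` function with compact support, in the
variable `t = log v`. -/
theorem tsum_log_sub_integral_exp_mul {h h' : ℝ → ℂ} (hd : ∀ t, HasDerivAt h (h' t) t)
    (hc : Continuous h') (hs : HasCompactSupport h) :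
    (∑' n : ℕ, h (Real.log (n + 1))) - ∫ t : ℝ, (Real.exp t : ℂ) * h t =
      ∫ t : ℝ, (Int.fract (Real.exp t) : ℝ) * h' t := by
  have hh : Continuous h := continuous_iff_continuousAt.2 fun t => (hd t).continuousAt
  have hs' : HasCompactSupport h' := by
    have : h' = deriv h := funext fun t => (hd t).deriv.symm
    rw [this]; exact hs.deriv
  have i' : Integrable h' := hc.integrable_of_hasCompactSupport hs'
  obtain ⟨R, hR⟩ := hs.isCompact.isBounded.subset_closedBall 0
  obtain ⟨N, hN⟩ := exists_nat_gt (Real.exp R)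
  have hz : ∀ t, R < t → h t = 0 := fun t ht => image_eq_zero_of_notMem_tsupport fun hm => by
    have := hR hm
    rw [Metric.mem_closedBall, dist_zero_right] at this
    linarith [Real.le_norm_self t]
  have hz' : ∀ t, R < t → h' t = 0 := fun t ht => by
    have : h =ᶠ[nhds t] fun _ => 0 := by
      filter_upwards [lt_mem_nhds ht] with x hx using hz x hx
    exact ((hd t).congr_of_eventuallyEq this.symm).unique (hasDerivAt_const t (0 : ℂ))
  have iexp : Integrable fun t : ℝ => (Real.exp t : ℂ) * h' t :=
    (Continuous.mul (by fun_prop) hc).integrable_of_hasCompactSupport hs'.mul_left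
  have ibp : ∫ t : ℝ, (Real.exp t : ℂ) * h' t = - ∫ t : ℝ, (Real.exp t : ℂ) * h t := by
    refine integral_mul_deriv_eq_deriv_mul_of_integrable
      (u := fun t : ℝ => (Real.exp t : ℂ)) (u' := fun t : ℝ => (Real.exp t : ℂ))
      (fun t _ => (Real.hasDerivAt_exp t).ofReal_comp) (fun t _ => hd t) iexp ?_ ?_ <;>
    exact (Continuous.mul (by fun_prop) hh).integrable_of_hasCompactSupport hs.mul_left
  -- ⌊e^t⌋ is a sum of unit steps at log 1, log 2, ...; integrating h' beyond log(n + 1) gives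
  -- -h(log(n + 1)). As N > e^R, the omitted steps lie beyond the support of h'.
  have hfl : ∀ t, ((⌊Real.exp t⌋ : ℤ) : ℂ) * h' t =
      ∑ n ∈ Finset.range N, (Ici (Real.log (n + 1))).indicator h' t := by
    intro t
    rcases lt_or_ge R t with ht | ht
    · rw [hz' t ht, mul_zero]
      refine (Finset.sum_eq_zero fun n _ => ?_).symm
      exact indicator_apply_eq_zero.2 fun _ => hz' t ht
    · have := cast_floor_eq_sum_range_ite (Real.exp_pos t).le
        ((Real.exp_le_exp.2 ht).trans hN.le)
      rw [← Complex.ofReal_intCast, this, Complex.ofReal_sum, Finset.sum_mul]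
      refine Finset.sum_congr rfl fun n _ => ?_
      have : (n : ℝ) + 1 ≤ Real.exp t ↔ t ∈ Ici (Real.log (n + 1)) := by
        rw [mem_Ici, Real.log_le_iff_le_exp (by positivity)]
      by_cases hm : t ∈ Ici (Real.log (n + 1))
      · simp [this, hm]
      · simp [this, hm]
  have iind : ∀ n : ℕ, Integrable ((Ici (Real.log (n + 1))).indicator h') := fun n =>
    i'.indicator measurableSet_Ici
  have e1 : ∫ t : ℝ, ((⌊Real.exp t⌋ : ℤ) : ℂ) * h' t =
      - ∑ n ∈ Finset.range N, h (Real.log (n + 1)) := by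
    simp_rw [hfl]
    rw [integral_finsetSum _ fun n _ => iind n, ← Finset.sum_neg_distrib]
    refine Finset.sum_congr rfl fun n _ => ?_
    rw [integral_indicator measurableSet_Ici, integral_Ici_eq_integral_Ioi,
      integral_Ioi_of_hasDerivAt_of_tendsto' (fun t _ => hd t) i'.integrableOn (m := 0), zero_sub]
    refine tendsto_const_nhds.congr' ?_
    filter_upwards [Filter.eventually_gt_atTop R] with t ht using (hz t ht).symm
  have ifl : Integrable fun t : ℝ => ((⌊Real.exp t⌋ : ℤ) : ℂ) * h' t := by
    simp_rw [hfl]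
    exact integrable_finsetSum _ fun n _ => iind n
  have e2 : ∑' n : ℕ, h (Real.log (n + 1)) = ∑ n ∈ Finset.range N, h (Real.log (n + 1)) := by
    refine tsum_eq_sum fun n hn => hz _ ?_
    rw [Finset.mem_range, not_lt] at hn
    rw [Real.lt_log_iff_exp_lt (by positivity)]
    have : (N : ℝ) ≤ n := by exact_mod_cast hn
    linarith
  have e3 : ∀ t : ℝ, ((Int.fract (Real.exp t) : ℝ) : ℂ) * h' t =
      (Real.exp t : ℂ) * h' t - ((⌊Real.exp t⌋ : ℤ) : ℂ) * h' t := by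
    intro t
    rw [Int.fract]; push_cast; ring
  simp_rw [e3]
  rw [integral_sub iexp ifl, ibp, e1, e2]
  ring

/-! ### Sums over the translates by log n -/

section DilationSum

variable {χ F : ℝ → ℂ} {R : ℝ}

/-- A nonzero term needs n + 1 ≤ e^{w+R}, so there are at most e^{w+R} of them. The growth e^w is
absorbed by the weight in the hypothesis on F below. -/
theorem sum_norm_shift_log_le {M : ℝ} (hM : ∀ u, ‖χ u‖ ≤ M) (hR : ∀ u, R < |u| → χ u = 0)
    (w : ℝ) (s : Finset ℕ) :
    ∑ n ∈ s, ‖χ (w - Real.log (n + 1))‖ ≤ M * Real.exp R * Real.exp w := by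
  have hM0 : 0 ≤ M := (norm_nonneg _).trans (hM 0)
  have hle : ∀ n : ℕ, ‖χ (w - Real.log (n + 1))‖ ≤
      if (n : ℝ) + 1 ≤ Real.exp (w + R) then M else 0 := by
    intro n
    split_ifs with h
    · exact hM _
    · rw [hR, norm_zero]
      rw [← Real.log_le_iff_le_exp (by positivity), not_le] at h
      exact lt_of_lt_of_le (by linarith) (neg_le_abs _)
  refine (Finset.sum_le_sum fun n _ => hle n).trans ?_
  rw [← Finset.sum_filter, Finset.sum_const, nsmul_eq_mul, mul_assoc, ← Real.exp_add, mul_comm,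
    add_comm R w]
  refine mul_le_mul_of_nonneg_left ?_ hM0
  have : (s.filter fun n : ℕ => (n : ℝ) + 1 ≤ Real.exp (w + R)) ⊆
      Finset.range ⌊Real.exp (w + R)⌋₊ := by
    intro n hn
    rw [Finset.mem_filter] at hn
    rw [Finset.mem_range, ← Nat.succ_le_iff, Nat.le_floor_iff (Real.exp_pos _).le]
    push_cast
    exact hn.2
  have h2 := Finset.card_le_card this
  rw [Finset.card_range] at h2
  exact (Nat.cast_le.2 h2).trans (Nat.floor_le (Real.exp_pos _).le)

theorem integrable_mul_of_exp_mul {M : ℝ} (hχ : AEStronglyMeasurable χ) (hM : ∀ u, ‖χ u‖ ≤ M)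
    (hR : ∀ u, R < |u| → χ u = 0) (hF : Integrable fun w : ℝ => (Real.exp w : ℂ) * F w)
    (n : ℕ) : Integrable fun w => χ (w - Real.log (n + 1)) * F w := by
  have hχ' : AEStronglyMeasurable fun w => χ (w - Real.log (n + 1)) :=
    hχ.comp_measurePreserving (measurePreserving_sub_right volume _)
  have hFm : AEStronglyMeasurable F := by
    have : F = fun w : ℝ => (Real.exp (-w) : ℂ) * ((Real.exp w : ℂ) * F w) := by
      ext w
      rw [← mul_assoc, ← Complex.ofReal_mul, ← Real.exp_add]; simp
    rw [this]
    exact (Continuous.aestronglyMeasurable (by fun_prop)).mul hF.1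
  refine (hF.norm.const_mul (M * Real.exp R)).mono' (hχ'.mul hFm)
    (Filter.Eventually.of_forall fun w => ?_)
  have := sum_norm_shift_log_le hM hR w {n}
  rw [Finset.sum_singleton] at this
  rw [norm_mul, norm_mul, Complex.norm_real, Real.norm_of_nonneg (Real.exp_pos w).le, ← mul_assoc]
  exact mul_le_mul_of_nonneg_right this (norm_nonneg _)

theorem summable_integral_norm_shift_log {M : ℝ} (hχ : AEStronglyMeasurable χ)
    (hM : ∀ u, ‖χ u‖ ≤ M) (hR : ∀ u, R < |u| → χ u = 0)
    (hF : Integrable fun w : ℝ => (Real.exp w : ℂ) * F w) :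
    Summable fun n : ℕ => ∫ w, ‖χ (w - Real.log (n + 1)) * F w‖ := by
  refine summable_of_sum_le (fun n => integral_nonneg fun _ => norm_nonneg _)
    (c := ∫ w, M * Real.exp R * ‖(Real.exp w : ℂ) * F w‖) fun s => ?_
  have hi := integrable_mul_of_exp_mul hχ hM hR hF
  rw [← integral_finsetSum _ fun n _ => (hi n).norm]
  refine integral_mono (integrable_finsetSum _ fun n _ => (hi n).norm)
    (hF.norm.const_mul _) fun w => ?_
  simp only [norm_mul, Complex.norm_real, Real.norm_of_nonneg (Real.exp_pos _).le]
  rw [← Finset.sum_mul, ← mul_assoc]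
  exact mul_le_mul_of_nonneg_right (sum_norm_shift_log_le hM hR w s) (norm_nonneg _)

theorem integrable_mul_shift {M : ℝ} (hχ : AEStronglyMeasurable χ) (hM : ∀ u, ‖χ u‖ ≤ M)
    (hR : ∀ u, R < |u| → χ u = 0) (hF : Integrable fun w : ℝ => (Real.exp w : ℂ) * F w)
    (n : ℕ) : Integrable fun u => χ u * F (u + Real.log (n + 1)) := by
  simpa using (integrable_mul_of_exp_mul hχ hM hR hF n).comp_add_right (Real.log (n + 1))

theorem summable_integral_norm_mul_shift {M : ℝ} (hχ : AEStronglyMeasurable χ)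
    (hM : ∀ u, ‖χ u‖ ≤ M) (hR : ∀ u, R < |u| → χ u = 0)
    (hF : Integrable fun w : ℝ => (Real.exp w : ℂ) * F w) :
    Summable fun n : ℕ => ∫ u, ‖χ u * F (u + Real.log (n + 1))‖ := by
  refine (summable_integral_norm_shift_log hχ hM hR hF).congr fun n => ?_
  rw [← integral_add_right_eq_self _ (Real.log (n + 1))]
  simp

/-- The sum and integral commute on both sides, and the terms match under w = u + log(n + 1). -/
theorem integral_mul_tsum_shift {M : ℝ} (hχ : AEStronglyMeasurable χ) (hM : ∀ u, ‖χ u‖ ≤ M)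
    (hR : ∀ u, R < |u| → χ u = 0) (hF : Integrable fun w : ℝ => (Real.exp w : ℂ) * F w) :
    ∫ u, χ u * ∑' n : ℕ, F (u + Real.log (n + 1)) =
      ∫ w, F w * ∑' n : ℕ, χ (w - Real.log (n + 1)) := by
  simp_rw [← tsum_mul_left]
  rw [← integral_tsum_of_summable_integral_norm (integrable_mul_shift hχ hM hR hF)
      (summable_integral_norm_mul_shift hχ hM hR hF)]
  simp_rw [mul_comm (F _) (χ _)]
  rw [← integral_tsum_of_summable_integral_norm (integrable_mul_of_exp_mul hχ hM hR hF)
      (summable_integral_norm_shift_log hχ hM hR hF)]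
  refine tsum_congr fun n => ?_
  rw [← integral_add_right_eq_self (fun w => χ (w - Real.log (n + 1)) * F w) (Real.log (n + 1))]
  simp

/-- Taking χ to be the indicator of [-k, k] gives the claim almost everywhere on that interval;
countably many k cover the line. -/
theorem ae_summable_norm_shift_log (hF : Integrable fun w : ℝ => (Real.exp w : ℂ) * F w) :
    ∀ᵐ u, Summable fun n : ℕ => ‖F (u + Real.log (n + 1))‖ := by
  have h : ∀ k : ℕ, ∀ᵐ u : ℝ, |u| ≤ k → Summable fun n : ℕ => ‖F (u + Real.log (n + 1))‖ := by
    intro k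
    set χ : ℝ → ℂ := (Icc (-(k : ℝ)) k).indicator fun _ => 1 with hχ
    have hm : AEStronglyMeasurable χ :=
      (measurable_const.indicator measurableSet_Icc).aestronglyMeasurable
    have hM : ∀ u, ‖χ u‖ ≤ 1 := fun u =>
      (norm_indicator_le_norm_self (fun _ => (1 : ℂ)) u).trans (by simp)
    have hR : ∀ u, (k : ℝ) < |u| → χ u = 0 := fun u hu =>
      indicator_of_notMem (fun h : u ∈ Icc _ _ => hu.not_ge (abs_le.2 h)) _
    filter_upwards [ae_summable_norm_of_summable_integral_norm
      (integrable_mul_shift hm hM hR hF) (summable_integral_norm_mul_shift hm hM hR hF)]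
      with u hu hk
    have : χ u = 1 := indicator_of_mem (show u ∈ Icc (-(k : ℝ)) k from abs_le.1 hk) _
    simpa [this] using hu
  filter_upwards [ae_all_iff.2 h] with u hu
  obtain ⟨k, hk⟩ := exists_nat_ge |u|
  exact hu k hk

theorem locallyIntegrable_tsum_shift_log
    (hF : Integrable fun w : ℝ => (Real.exp w : ℂ) * F w) :
    LocallyIntegrable fun u => ∑' n : ℕ, F (u + Real.log (n + 1)) := by
  have h : ∀ R : ℝ, IntegrableOn (fun u => ∑' n : ℕ, F (u + Real.log (n + 1))) (Icc (-R) R) := by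
    intro k
    set χ : ℝ → ℂ := (Icc (-k) k).indicator fun _ => 1 with hχ
    have hm : AEStronglyMeasurable χ :=
      (measurable_const.indicator measurableSet_Icc).aestronglyMeasurable
    have hM : ∀ u, ‖χ u‖ ≤ 1 := fun u =>
      (norm_indicator_le_norm_self (fun _ => (1 : ℂ)) u).trans (by simp)
    have hR : ∀ u, k < |u| → χ u = 0 := fun u hu =>
      indicator_of_notMem (fun h : u ∈ Icc _ _ => hu.not_ge (abs_le.2 h)) _
    have := (integrable_tsum_of_summable_integral_norm
      (integrable_mul_shift hm hM hR hF) (summable_integral_norm_mul_shift hm hM hR hF)).integrableOn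
        (s := Icc (-k) k)
    refine this.congr_fun (fun u hu => ?_) measurableSet_Icc
    have : χ u = 1 := indicator_of_mem hu _
    simp [this]
  intro x
  refine ⟨Icc (-(|x| + 1)) (|x| + 1), Icc_mem_nhds ?_ ?_, h _⟩
  · linarith [neg_abs_le x]
  · linarith [le_abs_self x]

end DilationSum

/-! ### Fourier integrals with integrable and Schwartz densities -/

/-- Fubini applies because the exponential kernel has modulus one. This transfers the Fourier
transform from one factor to the other. -/
theorem integral_mul_integral_exp_swap {a b : ℝ → ℂ} (ha : Integrable a) (hb : Integrable b) :
    ∫ τ : ℝ, a τ * ∫ w : ℝ, b w * Complex.exp (Complex.I * τ * w) =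
      ∫ w : ℝ, b w * ∫ τ : ℝ, a τ * Complex.exp (Complex.I * τ * w) := by
  simp_rw [← integral_const_mul]
  rw [integral_integral_swap]
  · refine integral_congr_ae (Filter.Eventually.of_forall fun w => ?_)
    refine integral_congr_ae (Filter.Eventually.of_forall fun τ => ?_)
    simp only; ring
  · refine (ha.mul_prod hb).mono ?_ (Filter.Eventually.of_forall fun p => ?_)
    · have : AEStronglyMeasurable (fun p : ℝ × ℝ => (a p.1 * b p.2) *
          Complex.exp (Complex.I * p.1 * p.2)) (volume.prod volume) :=
        (ha.mul_prod hb).1.mul (Continuous.aestronglyMeasurable (by fun_prop))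
      refine this.congr (Filter.Eventually.of_forall fun p => ?_)
      simp only [Function.uncurry]; ring
    · simp only [Function.uncurry]
      rw [norm_mul, norm_mul, norm_mul, mul_assoc Complex.I, ← Complex.ofReal_mul,
        mul_comm Complex.I, Complex.norm_exp_ofReal_mul_I, mul_one]

theorem norm_exp_I_mul_mul (x y : ℝ) : ‖Complex.exp (Complex.I * x * y)‖ = 1 := by
  rw [mul_assoc, ← Complex.ofReal_mul, mul_comm, Complex.norm_exp_ofReal_mul_I]

theorem continuous_integral_mul_exp {b : ℝ → ℂ} (hb : Integrable b) :
    Continuous fun τ : ℝ => ∫ w : ℝ, b w * Complex.exp (Complex.I * τ * w) := by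
  refine continuous_of_dominated (bound := fun w => ‖b w‖) (fun τ => ?_) (fun τ => ?_) hb.norm ?_
  · exact hb.1.mul (Continuous.aestronglyMeasurable (by fun_prop))
  · exact Filter.Eventually.of_forall fun w => by rw [norm_mul, norm_exp_I_mul_mul, mul_one]
  · exact Filter.Eventually.of_forall fun w => by fun_prop

theorem norm_integral_mul_exp_le (b : ℝ → ℂ) (τ : ℝ) :
    ‖∫ w : ℝ, b w * Complex.exp (Complex.I * τ * w)‖ ≤ ∫ w, ‖b w‖ := by
  refine (norm_integral_le_integral_norm _).trans (le_of_eq ?_)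
  simp only [norm_mul, norm_exp_I_mul_mul, mul_one]

theorem SchwartzMap.integrable_id_mul (ψ : 𝓢(ℝ, ℂ)) : Integrable fun τ : ℝ => ψ τ * (τ : ℂ) := by
  refine (ψ.integrable_pow_mul volume 1).mono'
    (Continuous.aestronglyMeasurable (by fun_prop)) (Filter.Eventually.of_forall fun τ => ?_)
  rw [norm_mul, Complex.norm_real, pow_one, mul_comm]

theorem SchwartzMap.integrable_mul_add_I_mul (ψ : 𝓢(ℝ, ℂ)) (σ : ℝ) :
    Integrable fun τ : ℝ => ψ τ * ((σ : ℂ) + Complex.I * τ) := by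
  refine ((ψ.integrable.mul_const (σ : ℂ)).add (ψ.integrable_id_mul.mul_const Complex.I)).congr
    (Filter.Eventually.of_forall fun τ => ?_)
  simp only [Pi.add_apply]; ring

theorem hasDerivAt_expFourierSchwartz (ψ : 𝓢(ℝ, ℂ)) (v : ℝ) :
    HasDerivAt (expFourierSchwartz ψ)
      (∫ τ : ℝ, ψ τ * (Complex.I * τ) * Complex.exp (Complex.I * τ * v)) v := by
  have e : (expFourierSchwartz ψ : ℝ → ℂ) =
      fun u : ℝ => ∫ τ : ℝ, ψ τ * Complex.exp (Complex.I * τ * u) :=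
    funext fun u => expFourierSchwartz_apply ψ u
  rw [e]
  refine (hasDerivAt_integral_of_dominated_loc_of_deriv_le (s := univ)
    (bound := fun τ : ℝ => ‖ψ τ * (τ : ℂ)‖)
    (F' := fun v τ : ℝ => ψ τ * (Complex.I * τ) * Complex.exp (Complex.I * τ * v))
    Filter.univ_mem ?_ ?_ ?_ ?_ ψ.integrable_id_mul.norm ?_).2
  · exact Filter.Eventually.of_forall fun u => Continuous.aestronglyMeasurable (by fun_prop)
  · refine ψ.integrable.norm.mono' (Continuous.aestronglyMeasurable (by fun_prop))
      (Filter.Eventually.of_forall fun τ => ?_)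
    rw [norm_mul, norm_exp_I_mul_mul, mul_one]
  · exact Continuous.aestronglyMeasurable (by fun_prop)
  · refine Filter.Eventually.of_forall fun τ u _ => le_of_eq ?_
    rw [norm_mul, norm_exp_I_mul_mul, mul_one, norm_mul, norm_mul, norm_mul, Complex.norm_I,
      one_mul]
  · refine Filter.Eventually.of_forall fun τ u _ => ?_
    have h1 : HasDerivAt (fun u : ℝ => Complex.I * τ * (u : ℂ)) (Complex.I * τ) u := by
      simpa using (Complex.ofRealCLM.hasDerivAt (x := u)).const_mul (Complex.I * (τ : ℂ))
    refine (h1.cexp.const_mul (ψ τ)).congr_deriv ?_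
    ring

/-- `e^{-σv} (e^{σv} φ(v))'` has the Fourier representation with density `(σ + iτ) ψ(τ)`. -/
theorem hasDerivAt_exp_mul_expFourierSchwartz (ψ : 𝓢(ℝ, ℂ)) (σ v : ℝ) :
    HasDerivAt (fun v : ℝ => (Real.exp (σ * v) : ℂ) * expFourierSchwartz ψ v)
      ((Real.exp (σ * v) : ℂ) *
        ∫ τ : ℝ, ψ τ * ((σ : ℂ) + Complex.I * τ) * Complex.exp (Complex.I * τ * v)) v := by
  have h1 : HasDerivAt (fun v : ℝ => (Real.exp (σ * v) : ℂ)) ((Real.exp (σ * v) * σ : ℝ) : ℂ) v := by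
    have : HasDerivAt (fun v : ℝ => Real.exp (σ * v)) (Real.exp (σ * v) * σ) v := by
      simpa using ((hasDerivAt_id v).const_mul σ).exp
    exact this.ofReal_comp
  refine (h1.mul (hasDerivAt_expFourierSchwartz ψ v)).congr_deriv ?_
  rw [expFourierSchwartz_apply]
  have i1 : Integrable fun τ : ℝ => ψ τ * Complex.exp (Complex.I * τ * v) := by
    refine ψ.integrable.norm.mono' (Continuous.aestronglyMeasurable (by fun_prop))
      (Filter.Eventually.of_forall fun τ => ?_)
    rw [norm_mul, norm_exp_I_mul_mul, mul_one]
  have i2 : Integrable fun τ : ℝ => ψ τ * (Complex.I * τ) * Complex.exp (Complex.I * τ * v) := by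
    refine ψ.integrable_id_mul.norm.mono' (Continuous.aestronglyMeasurable (by fun_prop))
      (Filter.Eventually.of_forall fun τ => ?_)
    rw [norm_mul, norm_exp_I_mul_mul, mul_one, norm_mul, norm_mul, norm_mul, Complex.norm_I,
      one_mul]
  have e : ∀ τ : ℝ, ψ τ * ((σ : ℂ) + Complex.I * τ) * Complex.exp (Complex.I * τ * v) =
      (σ : ℂ) * (ψ τ * Complex.exp (Complex.I * τ * v)) +
        ψ τ * (Complex.I * τ) * Complex.exp (Complex.I * τ * v) := fun τ => by ring
  simp_rw [e]
  rw [integral_add (i1.const_mul _) i2, integral_const_mul]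
  push_cast
  ring

/-! ### The Müntz formula for test functions -/

theorem muntzSum_exp (f : ℝ → ℂ) (u : ℝ) :
    muntzSum f (Real.exp u) = (∑' n : ℕ, f (Real.exp (u + Real.log (n + 1)))) -
      (∫ w : ℝ, (Real.exp w : ℂ) * f (Real.exp w)) * (Real.exp (-u) : ℂ) := by
  rw [muntzSum, integral_Ioi_zero_eq_integral_exp, Real.exp_neg, Complex.ofReal_inv,
    ← div_eq_mul_inv]
  congr 2
  · ext n
    rw [Real.exp_add, Real.exp_log (by positivity), mul_comm]

/-- The Müntz formula for a test function `φ = expFourierSchwartz ψ` with compact support. -/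
theorem tsum_shift_sub_eq_integral_fract {ψ : 𝓢(ℝ, ℂ)}
    (hc : HasCompactSupport (expFourierSchwartz ψ : ℝ → ℂ)) {σ : ℝ} (h0 : 0 < σ) (h1 : σ < 1)
    (w : ℝ) :
    (∑' n : ℕ, (Real.exp (σ * (w - Real.log (n + 1))) : ℂ) *
        expFourierSchwartz ψ (w - Real.log (n + 1))) -
      (Real.exp w : ℂ) * (∫ u : ℝ, (Real.exp (-u) : ℂ) *
        ((Real.exp (σ * u) : ℂ) * expFourierSchwartz ψ u)) =
    (Real.exp (σ * w) : ℂ) * ∫ τ : ℝ, ψ τ * riemannZeta ((σ : ℂ) + Complex.I * τ) *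
      Complex.exp (Complex.I * τ * w) := by
  set χ : ℝ → ℂ := fun v => (Real.exp (σ * v) : ℂ) * expFourierSchwartz ψ v with hχ
  set P : ℝ → ℂ := fun τ => ψ τ * ((σ : ℂ) + Complex.I * τ) with hP
  have hχs : HasCompactSupport χ :=
    HasCompactSupport.mul_left (f := fun v : ℝ => (Real.exp (σ * v) : ℂ)) hc
  set D : ℝ → ℂ := fun v => ∫ τ : ℝ, P τ * Complex.exp (Complex.I * τ * v) with hD
  set k : ℝ → ℂ := fun t => ((Int.fract (Real.exp t) * Real.exp (-σ * t) : ℝ) : ℂ) with hk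
  have hPi : Integrable P := ψ.integrable_mul_add_I_mul σ
  have hki : Integrable k := (integrable_fract_exp_mul h0 h1).ofReal
  have hDc : Continuous D := by
    simpa only [hD, mul_right_comm Complex.I] using continuous_integral_mul_exp hPi
  -- Euler-Maclaurin for the reflected translate t ↦ χ(w - t); the reflection accounts for the minus
  -- sign in the derivative.
  have key := tsum_log_sub_integral_exp_mul (h := fun t => χ (w - t))
    (h' := fun t => -((Real.exp (σ * (w - t)) : ℂ) * D (w - t)))
    (fun t => (hasDerivAt_exp_mul_expFourierSchwartz ψ σ (w - t)).comp_const_sub w t)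
    (by fun_prop) (hχs.comp_homeomorph (Homeomorph.subLeft w))
  have e1 : ∫ t : ℝ, (Real.exp t : ℂ) * χ (w - t) =
      (Real.exp w : ℂ) * ∫ u : ℝ, (Real.exp (-u) : ℂ) * χ u := by
    rw [← integral_sub_left_eq_self _ volume w, ← integral_const_mul]
    refine integral_congr_ae (Filter.Eventually.of_forall fun u => ?_)
    simp only [sub_sub_cancel]
    rw [sub_eq_add_neg, Real.exp_add, Complex.ofReal_mul, mul_assoc]
  rw [e1] at key
  rw [key]
  have e2 : ∀ t : ℝ, ((Int.fract (Real.exp t) : ℝ) : ℂ) *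
      -((Real.exp (σ * (w - t)) : ℂ) * D (w - t)) =
      (Real.exp (σ * w) : ℂ) * -(k t * D (w - t)) := by
    intro t
    rw [hk, mul_sub, sub_eq_add_neg, Real.exp_add, ← neg_mul]
    push_cast
    ring_nf
  simp_rw [e2]
  -- The substitution t ↦ -t turns the phase e^{iτ(w-t)} into e^{iτw} e^{iτt}, the kernel of the
  -- swap lemma.
  rw [integral_const_mul, integral_neg, ← integral_neg_eq_self]
  congr 1
  have e3 : ∀ t : ℝ, k (-t) * D (w - -t) = k (-t) * ∫ τ : ℝ,
      (P τ * Complex.exp (Complex.I * τ * w)) * Complex.exp (Complex.I * τ * t) := by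
    intro t
    congr 1
    refine integral_congr_ae (Filter.Eventually.of_forall fun τ => ?_)
    simp only [mul_assoc, ← Complex.exp_add]
    congr 3
    push_cast; ring
  simp_rw [e3]
  have hPi' : Integrable fun τ : ℝ => P τ * Complex.exp (Complex.I * τ * w) := by
    refine hPi.norm.mono' (hPi.1.mul (Continuous.aestronglyMeasurable (by fun_prop)))
      (Filter.Eventually.of_forall fun τ => ?_)
    rw [norm_mul, norm_exp_I_mul_mul, mul_one]
  rw [← integral_mul_integral_exp_swap hPi' hki.comp_neg, ← integral_neg]
  refine integral_congr_ae (Filter.Eventually.of_forall fun τ => ?_)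
  have e4 : ∫ t : ℝ, k (-t) * Complex.exp (Complex.I * τ * t) =
      ∫ t : ℝ, k t * Complex.exp (-(Complex.I * τ * t)) := by
    rw [← integral_neg_eq_self]
    simp
  simp only [riemannZeta_eq_neg_mul_integral_fract h0 h1, e4, hP]
  ring

/-! ### The product of zeta and the Mellin transform as a tempered distribution -/

section ZetaMellin

variable {f : ℝ → ℂ} {σ : ℝ}

/-- The bounded factor of `ζ(σ + iτ) f̂(σ + iτ)`, which is this times `σ + iτ`. -/
noncomputable def zetaMellinFactor (f : ℝ → ℂ) (σ τ : ℝ) : ℂ :=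
  -(∫ t : ℝ, ((Int.fract (Real.exp t) * Real.exp (-σ * t) : ℝ) : ℂ) *
      Complex.exp (-(Complex.I * τ * t))) *
    ∫ u : ℝ, (Real.exp (σ * u) * f (Real.exp u)) * Complex.exp (Complex.I * τ * u)

theorem riemannZeta_mul_mellin_eq (h0 : 0 < σ) (h1 : σ < 1) (τ : ℝ) :
    riemannZeta ((σ : ℂ) + Complex.I * τ) * mellin f ((σ : ℂ) + Complex.I * τ) =
      ((σ : ℂ) + Complex.I * τ) * zetaMellinFactor f σ τ := by
  rw [riemannZeta_eq_neg_mul_integral_fract h0 h1, mellin_eq_integral_exp, zetaMellinFactor]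
  ring

theorem continuous_integral_fract_exp (h0 : 0 < σ) (h1 : σ < 1) :
    Continuous fun τ : ℝ => ∫ t : ℝ,
      ((Int.fract (Real.exp t) * Real.exp (-σ * t) : ℝ) : ℂ) *
        Complex.exp (-(Complex.I * τ * t)) := by
  have h := (continuous_integral_mul_exp
    ((integrable_fract_exp_mul h0 h1).ofReal (𝕜 := ℂ))).comp continuous_neg
  simpa [Function.comp_def] using h

theorem memLp_top_zetaMellinFactor (h0 : 0 < σ) (h1 : σ < 1)
    (hG : Integrable fun u : ℝ => (Real.exp (σ * u) : ℂ) * f (Real.exp u)) :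
    MemLp (zetaMellinFactor f σ) ⊤ volume := by
  have hk := (integrable_fract_exp_mul h0 h1).ofReal (𝕜 := ℂ)
  refine memLp_top_of_bound (Continuous.aestronglyMeasurable
    ((continuous_integral_fract_exp h0 h1).neg.mul (continuous_integral_mul_exp hG)))
    ((∫ t, ‖((Int.fract (Real.exp t) * Real.exp (-σ * t) : ℝ) : ℂ)‖) *
      ∫ u, ‖(Real.exp (σ * u) : ℂ) * f (Real.exp u)‖) (Filter.Eventually.of_forall fun τ => ?_)
  rw [zetaMellinFactor, norm_mul, norm_neg]
  refine mul_le_mul ?_ (norm_integral_mul_exp_le _ τ) (norm_nonneg _)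
    (integral_nonneg fun _ => norm_nonneg _)
  have := norm_integral_mul_exp_le
    (fun t => ((Int.fract (Real.exp t) * Real.exp (-σ * t) : ℝ) : ℂ)) (-τ)
  simpa using this

theorem integrable_mul_zeta_mul_mellin (h0 : 0 < σ) (h1 : σ < 1)
    (hG : Integrable fun u : ℝ => (Real.exp (σ * u) : ℂ) * f (Real.exp u)) (φ : 𝓢(ℝ, ℂ)) :
    Integrable fun τ : ℝ => φ τ * (riemannZeta ((σ : ℂ) + Complex.I * (τ : ℂ)) *
      mellin f ((σ : ℂ) + Complex.I * (τ : ℂ))) := by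
  simp_rw [riemannZeta_mul_mellin_eq h0 h1, ← mul_assoc]
  exact (φ.integrable_mul_add_I_mul σ).mul_of_top_left (memLp_top_zetaMellinFactor h0 h1 hG)

/-- A bounded function is a tempered distribution, and multiplication by σ + iτ, which has temperate
growth, preserves these. -/
theorem exists_temperedDistribution_zeta_mul_mellin (h0 : 0 < σ) (h1 : σ < 1)
    (hG : Integrable fun u : ℝ => (Real.exp (σ * u) : ℂ) * f (Real.exp u)) :
    ∃ T : 𝓢'(ℝ, ℂ), ∀ φ : 𝓢(ℝ, ℂ), T φ = ∫ τ : ℝ, φ τ *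
      (riemannZeta ((σ : ℂ) + Complex.I * (τ : ℂ)) * mellin f ((σ : ℂ) + Complex.I * (τ : ℂ))) := by
  have hm := memLp_top_zetaMellinFactor h0 h1 hG
  have hg : (fun τ : ℝ => (σ : ℂ) + Complex.I * (τ : ℂ)).HasTemperateGrowth := by fun_prop
  have : Fact ((1 : ENNReal) ≤ ⊤) := ⟨le_top⟩
  refine ⟨TemperedDistribution.smulLeftCLM ℂ (fun τ : ℝ => (σ : ℂ) + Complex.I * (τ : ℂ))
    (Lp.toTemperedDistribution (hm.toLp _)), fun φ => ?_⟩
  rw [TemperedDistribution.smulLeftCLM_apply_apply, Lp.toTemperedDistribution_apply]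
  refine integral_congr_ae ?_
  filter_upwards [hm.coeFn_toLp] with τ hτ
  rw [hτ, SchwartzMap.smulLeftCLM_apply_apply hg, riemannZeta_mul_mellin_eq h0 h1]
  simp only [smul_eq_mul]
  ring

/-- The pairing of T with ψ is the pairing of x^σ A_f with the transform of ψ. The two correction
terms agree: each is the product of ∫ f and ∫ e^{-u} χ(u) du. -/
theorem integral_mul_zeta_mul_mellin_eq (h0 : 0 < σ) (h1 : σ < 1)
    (hG : Integrable fun u : ℝ => (Real.exp (σ * u) : ℂ) * f (Real.exp u))
    (hF : Integrable fun u : ℝ => (Real.exp u : ℂ) * f (Real.exp u)) {ψ : 𝓢(ℝ, ℂ)}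
    (hc : HasCompactSupport (expFourierSchwartz ψ : ℝ → ℂ)) :
    ∫ τ : ℝ, ψ τ * (riemannZeta ((σ : ℂ) + Complex.I * (τ : ℂ)) *
      mellin f ((σ : ℂ) + Complex.I * (τ : ℂ))) =
    ∫ u : ℝ, expFourierSchwartz ψ u *
      (((Real.exp u ^ σ : ℝ) : ℂ) * muntzSum f (Real.exp u)) := by
  set χ : ℝ → ℂ := fun v => (Real.exp (σ * v) : ℂ) * expFourierSchwartz ψ v with hχ
  have hχc : Continuous χ := by fun_prop
  have hχs : HasCompactSupport χ :=
    HasCompactSupport.mul_left (f := fun v : ℝ => (Real.exp (σ * v) : ℂ)) hc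
  have hχm : AEStronglyMeasurable χ := hχc.aestronglyMeasurable
  obtain ⟨M, hM⟩ := hχs.exists_bound_of_continuous hχc
  obtain ⟨R, hR⟩ := hχs.isCompact.isBounded.subset_closedBall 0
  have hR' : ∀ u, R < |u| → χ u = 0 := fun u hu => image_eq_zero_of_notMem_tsupport fun hm => by
    have := hR hm
    rw [Metric.mem_closedBall, dist_zero_right, Real.norm_eq_abs] at this
    exact hu.not_ge this
  set c : ℂ := ∫ u : ℝ, (Real.exp (-u) : ℂ) * χ u with hcdef
  set J : ℂ := ∫ w : ℝ, (Real.exp w : ℂ) * f (Real.exp w) with hJ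
  -- On the line Re s = σ, ζ is at most a constant times |σ + iτ|, which the Schwartz decay of ψ
  -- absorbs.
  have hPζ : Integrable fun τ : ℝ => ψ τ * riemannZeta ((σ : ℂ) + Complex.I * τ) := by
    have hk := (integrable_fract_exp_mul h0 h1).ofReal (𝕜 := ℂ)
    simp_rw [riemannZeta_eq_neg_mul_integral_fract h0 h1, ← mul_assoc, mul_neg]
    refine (ψ.integrable_mul_add_I_mul σ).neg.mul_bdd
      (c := ∫ t, ‖((Int.fract (Real.exp t) * Real.exp (-σ * t) : ℝ) : ℂ)‖)
      (continuous_integral_fract_exp h0 h1).aestronglyMeasurable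
      (Filter.Eventually.of_forall fun τ => ?_)
    have := norm_integral_mul_exp_le
      (fun t => ((Int.fract (Real.exp t) * Real.exp (-σ * t) : ℝ) : ℂ)) (-τ)
    simpa using this
  have e1 : ∫ τ : ℝ, ψ τ * (riemannZeta ((σ : ℂ) + Complex.I * (τ : ℂ)) *
      mellin f ((σ : ℂ) + Complex.I * (τ : ℂ))) =
      ∫ w : ℝ, f (Real.exp w) * (∑' n : ℕ, χ (w - Real.log (n + 1))) -
        (Real.exp w : ℂ) * f (Real.exp w) * c := by
    simp_rw [mellin_eq_integral_exp, ← mul_assoc (ψ _)]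
    rw [integral_mul_integral_exp_swap hPζ hG]
    refine integral_congr_ae (Filter.Eventually.of_forall fun w => ?_)
    have := tsum_shift_sub_eq_integral_fract hc h0 h1 w
    simp only
    rw [mul_right_comm, ← this]
    simp only [hχ, hcdef]
    ring
  have e2 : ∀ u : ℝ, expFourierSchwartz ψ u *
      (((Real.exp u ^ σ : ℝ) : ℂ) * muntzSum f (Real.exp u)) =
      χ u * (∑' n : ℕ, f (Real.exp (u + Real.log (n + 1)))) -
        ((Real.exp (-u) : ℂ) * χ u) * J := by
    intro u
    rw [muntzSum_exp, ← Real.exp_mul, mul_comm u σ]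
    simp only [hχ, hJ]
    ring
  have i1 : Integrable fun w => f (Real.exp w) * ∑' n : ℕ, χ (w - Real.log (n + 1)) := by
    have := integrable_tsum_of_summable_integral_norm
      (integrable_mul_of_exp_mul (F := fun w => f (Real.exp w)) hχm hM hR' hF)
      (summable_integral_norm_shift_log (F := fun w => f (Real.exp w)) hχm hM hR' hF)
    simp_rw [tsum_mul_right] at this
    simpa only [mul_comm] using this
  have i2 : Integrable fun u => χ u * ∑' n : ℕ, f (Real.exp (u + Real.log (n + 1))) := by
    have := integrable_tsum_of_summable_integral_norm
      (integrable_mul_shift (F := fun w => f (Real.exp w)) hχm hM hR' hF)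
      (summable_integral_norm_mul_shift (F := fun w => f (Real.exp w)) hχm hM hR' hF)
    simp_rw [tsum_mul_left] at this
    exact this
  have i3 : Integrable fun u : ℝ => (Real.exp (-u) : ℂ) * χ u :=
    (Continuous.mul (by fun_prop) hχc).integrable_of_hasCompactSupport
      (HasCompactSupport.mul_left (f := fun u : ℝ => (Real.exp (-u) : ℂ)) hχs)
  simp_rw [e2]
  rw [e1, integral_sub i1 (hF.mul_const c), integral_sub i2 (i3.mul_const J),
    integral_mul_const, integral_mul_const,
    integral_mul_tsum_shift (F := fun w => f (Real.exp w)) hχm hM hR' hF, mul_comm]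

end ZetaMellin

/-! ### Fourier inversion and the main theorem -/

/-- The inverse of `expFourierSchwartz`. -/
noncomputable def expFourierSchwartzInv : 𝓢(ℝ, ℂ) →L[ℂ] 𝓢(ℝ, ℂ) :=
  (FourierTransform.fourierCLM ℂ 𝓢(ℝ, ℂ)).comp
    (SchwartzMap.compCLMOfContinuousLinearEquiv ℂ
      (ContinuousLinearEquiv.unitsEquivAut ℝ
        (Units.mk0 (2 * Real.pi)⁻¹ (inv_ne_zero Real.two_pi_pos.ne'))).symm)

theorem expFourierSchwartz_expFourierSchwartzInv (φ : 𝓢(ℝ, ℂ)) :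
    expFourierSchwartz (expFourierSchwartzInv φ) = φ := by
  ext u
  simp only [expFourierSchwartz, expFourierSchwartzInv, ContinuousLinearMap.comp_apply,
    FourierTransform.fourierCLM_apply, FourierTransform.fourierInvCLM_apply,
    FourierTransform.fourierInv_fourier_eq, SchwartzMap.compCLMOfContinuousLinearEquiv_apply,
    Function.comp_apply, ContinuousLinearEquiv.symm_apply_apply]

theorem expFourierSchwartzInv_expFourierSchwartz (φ : 𝓢(ℝ, ℂ)) :
    expFourierSchwartzInv (expFourierSchwartz φ) = φ := by
  have h : ∀ χ : 𝓢(ℝ, ℂ), SchwartzMap.compCLMOfContinuousLinearEquiv ℂ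
      (ContinuousLinearEquiv.unitsEquivAut ℝ
        (Units.mk0 (2 * Real.pi)⁻¹ (inv_ne_zero Real.two_pi_pos.ne'))).symm
      (SchwartzMap.compCLMOfContinuousLinearEquiv ℂ (ContinuousLinearEquiv.unitsEquivAut ℝ
        (Units.mk0 (2 * Real.pi)⁻¹ (inv_ne_zero Real.two_pi_pos.ne'))) χ) = χ := by
    intro χ
    ext u
    simp only [SchwartzMap.compCLMOfContinuousLinearEquiv_apply, Function.comp_apply,
      ContinuousLinearEquiv.apply_symm_apply]
  simp only [expFourierSchwartz, expFourierSchwartzInv, ContinuousLinearMap.comp_apply, h,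
    FourierTransform.fourierCLM_apply, FourierTransform.fourierInvCLM_apply,
    FourierTransform.fourier_fourierInv_eq]

theorem mainTheorem6 (f : ℝ → ℂ) (hf : IntegrableOn f (Ioi (0 : ℝ)) volume)
    (σ : ℝ) (hσ0 : 0 < σ) (hσ1 : σ < 1)
    (hfσ : IntegrableOn (fun x : ℝ => ‖f x‖ * x ^ (σ - 1)) (Ioi (0 : ℝ)) volume) :
    (∀ᵐ x : ℝ ∂(volume.restrict (Ioi (0 : ℝ))),
      Summable (fun n : ℕ => ‖f (((n : ℝ) + 1) * x)‖)) ∧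
    ∃ S : 𝓢'(ℝ, ℂ),
      IsTemperedExtension
        (fun u : ℝ => ((Real.exp u ^ σ : ℝ) : ℂ) * muntzSum f (Real.exp u)) S ∧
      ∀ φ : 𝓢(ℝ, ℂ),
        Integrable (fun τ : ℝ => φ τ * (riemannZeta ((σ : ℂ) + Complex.I * (τ : ℂ)) *
          mellin f ((σ : ℂ) + Complex.I * (τ : ℂ)))) volume ∧
        expFourier S φ = ∫ τ : ℝ, φ τ * (riemannZeta ((σ : ℂ) + Complex.I * (τ : ℂ)) *
          mellin f ((σ : ℂ) + Complex.I * (τ : ℂ))) := by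
  have hF : Integrable fun u : ℝ => (Real.exp u : ℂ) * f (Real.exp u) := by
    simpa only [Complex.real_smul] using (integrableOn_Ioi_zero_iff_integrable_exp f).1 hf
  have hG : Integrable fun u : ℝ => (Real.exp (σ * u) : ℂ) * f (Real.exp u) := by
    have h := (integrableOn_Ioi_zero_iff_integrable_exp _).1 hfσ
    refine h.mono ?_ (Filter.Eventually.of_forall fun u => le_of_eq ?_)
    -- The weighted hypothesis sees only ‖f‖, so measurability of f comes from its integrability.
    · have : (fun u : ℝ => (Real.exp (σ * u) : ℂ) * f (Real.exp u)) =
          fun u : ℝ => (Real.exp ((σ - 1) * u) : ℂ) * ((Real.exp u : ℂ) * f (Real.exp u)) := by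
        ext u
        rw [← mul_assoc, ← Complex.ofReal_mul, ← Real.exp_add]
        ring_nf
      rw [this]
      exact (Continuous.aestronglyMeasurable (by fun_prop)).mul hF.1
    · simp only [norm_mul, norm_smul, Complex.norm_real, Real.norm_eq_abs, abs_norm, Real.abs_exp]
      rw [← Real.exp_mul, Real.abs_exp, mul_left_comm, ← Real.exp_add, mul_comm]
      ring_nf
  refine ⟨?_, ?_⟩
  · have hae := ae_summable_norm_shift_log hF
    rw [ae_restrict_iff' measurableSet_Ioi]
    -- The exponential is differentiable, so it carries the exceptional null set of u = log x to a
    -- null set of x.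
    have h0 := addHaar_image_eq_zero_of_differentiableOn_of_addHaar_eq_zero volume
      (Real.differentiable_exp.differentiableOn) (ae_iff.1 hae)
    refine measure_mono_null (fun x hx => ?_) h0
    simp only [mem_compl_iff, mem_ofPred_eq, Classical.not_imp] at hx
    refine ⟨Real.log x, ?_, Real.exp_log hx.1⟩
    have hx0 : 0 < x := hx.1
    simp only [mem_ofPred_eq, Real.exp_add, Real.exp_log hx0]
    intro h
    refine hx.2 (h.congr fun n => ?_)
    rw [Real.exp_log (by positivity), mul_comm]
  · obtain ⟨T, hT⟩ := exists_temperedDistribution_zeta_mul_mellin hσ0 hσ1 hG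
    -- S is the inverse transform of T by duality, so only its agreement with x^σ A_f on compactly
    -- supported tests requires the Müntz formula.
    refine ⟨PointwiseConvergenceCLM.precomp ℂ expFourierSchwartzInv T, ⟨?_, fun φ hφ => ?_⟩,
      fun φ => ⟨integrable_mul_zeta_mul_mellin hσ0 hσ1 hG φ, ?_⟩⟩
    · simp_rw [muntzSum_exp, ← Real.exp_mul]
      have h1 : LocallyIntegrable fun u : ℝ => (∑' n : ℕ, f (Real.exp (u + Real.log (n + 1)))) -
          (∫ w : ℝ, (Real.exp w : ℂ) * f (Real.exp w)) * (Real.exp (-u) : ℂ) :=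
        (locallyIntegrable_tsum_shift_log hF).sub (Continuous.locallyIntegrable (by fun_prop))
      rw [← locallyIntegrableOn_univ] at h1 ⊢
      exact h1.continuousOn_mul (Continuous.continuousOn (by fun_prop)) isOpen_univ.isLocallyClosed
    · have h := integral_mul_zeta_mul_mellin_eq hσ0 hσ1 hG hF
        (ψ := expFourierSchwartzInv φ) (by rwa [expFourierSchwartz_expFourierSchwartzInv])
      rw [expFourierSchwartz_expFourierSchwartzInv] at h
      rw [← h, ← hT]
      rfl
    · rw [expFourier_apply, ← hT]
      exact congrArg T (expFourierSchwartzInv_expFourierSchwartz φ)
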